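/- Let $2\le\Delta_B<\Delta_C$ be integers. For $n,m$ with $n\Delta_B=m\Delta_C$, the $(\Delta_B,\Delta_C)$-LDPC ensemble with $n$ bits and $m$ checks is the uniform distribution on all bijections (Tanner multigraphs) from $\{1,\dots,n\}\times\{1,\dots,\Delta_B\}$ (bit sockets) to $\{1,\dots,m\}\times\{1,\dots,\Delta_C\}$ (check sockets). The code of such a graph has the parity-check matrix $H\in\mathbb{F}_2^{m\times n}$ for which $H_{ci}$ is the number of edges between check $c$ and bit $i$, modulo $2$. Put $$\mathcal H(z)=-\sum_{c=1}^m\ \prod_{i:\,H_{ci}=1}z_i\quad(z\in\{\pm1\}^n),\qquad Z_H(\beta)=\sum_{z\in\{\pm1\}^n}e^{-\beta\mathcal H(z)} .$$ Let $(n_j)$ be a strictly increasing sequence of block lengths, with $n_j\Delta_B=m_j\Delta_C$ for integers $m_j$, and let $H_j$ $(j\ge 0)$ be the parity-check matrices of random Tanner graphs, all defined on one probability space (with any joint distribution), the $j$-th graph being drawn from the $(\Delta_B,\Delta_C)$-LDPC ensemble with $n_j$ bits and $m_j$ checks. Then, almost surely, the free energy density $$f(\beta)=\lim_{j\to\infty}\left[-\frac{1}{n_j\beta}\log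 Z_{H_j}(\beta)\right]$$ exists for every $0<\beta<\infty$ simultaneously, is a smooth ($C^\infty$) function of $\beta\in(0,\infty)$, and equals $$f(\beta)=-\frac1\beta\left[\log 2+\frac{\Delta_B}{\Delta_C}\log\cosh\beta\right].$$ -/

import Mathlib

open MeasureTheory ProbabilityTheory Filter Topology

/-- A Tanner (multi)graph of the regular `(ΔB, ΔC)` configuration model with `n` bits and `m`
checks: every bit `i` emits the `ΔB` edge sockets `(i, a)`, every check `c` emits the `ΔC` edge
sockets `(c, b)`, and the sockets are matched bijectively. There is one iff `n * ΔB = m * ΔC`. -/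
def TannerGraph (ΔB ΔC n m : ℕ) : Type :=
  (Fin n × Fin ΔB) ≃ (Fin m × Fin ΔC)

/-- Tanner graphs with given parameters form a finite set: every subset is an event. -/
instance TannerGraph.instMeasurableSpace (ΔB ΔC n m : ℕ) :
    MeasurableSpace (TannerGraph ΔB ΔC n m) := ⊤

/-- The check at the other end of the edge leaving the `a`-th socket of bit `i`. -/
def TannerGraph.check {ΔB ΔC n m : ℕ} (G : TannerGraph ΔB ΔC n m) (i : Fin n) (a : Fin ΔB) :
    Fin m :=
  (Equiv.toFun G (i, a)).1

/-- The parity-check matrix over `𝔽₂`: the bipartite adjacency matrix of the Tanner graph, so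
`H c i` is the number of edges between check `c` and bit `i`, modulo 2. -/
def TannerGraph.parityCheck {ΔB ΔC n m : ℕ} (G : TannerGraph ΔB ΔC n m) :
    Matrix (Fin m) (Fin n) (ZMod 2) :=
  fun c i => ((Finset.univ.filter fun a : Fin ΔB => G.check i a = c).card : ZMod 2)

/-- The `(ΔB, ΔC)`-LDPC ensemble with `n` bits and `m` checks: the uniform probability measure on
Tanner graphs (it is a probability measure iff `n * ΔB = m * ΔC`). -/
noncomputable def ldpcEnsemble (ΔB ΔC n m : ℕ) : Measure (TannerGraph ΔB ΔC n m) :=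
  uniformOn Set.univ

/-- The Hamiltonian `ℋ(z) = - ∑_c ∏_{i : H c i = 1} z_i` of a parity-check matrix, on spin
configurations `z ∈ {±1}ⁿ` (`ℤˣ = {1, -1}`). -/
def codeHamiltonian {n m : ℕ} (H : Matrix (Fin m) (Fin n) (ZMod 2)) (z : Fin n → ℤˣ) : ℝ :=
  -∑ c : Fin m, ∏ i ∈ Finset.univ.filter (fun i : Fin n => H c i = 1), (((z i : ℤˣ) : ℤ) : ℝ)

/-- The partition function `Z_H(β) = ∑_{z ∈ {±1}ⁿ} exp (-β ℋ(z))`. -/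
noncomputable def partitionFunction {n m : ℕ} (H : Matrix (Fin m) (Fin n) (ZMod 2)) (β : ℝ) : ℝ :=
  ∑ z : Fin n → ℤˣ, Real.exp (-β * codeHamiltonian H z)

/-- The free energy per bit at finite size, `-(1 / (n β)) log Z_H(β)`. -/
noncomputable def freeEnergyPerBit {n m : ℕ} (H : Matrix (Fin m) (Fin n) (ZMod 2)) (β : ℝ) : ℝ :=
  -(1 / ((n : ℝ) * β)) * Real.log (partitionFunction H β)

/-! Writing each factor exp(±β) as cosh β · (1 ± tanh β) and averaging over spins gives Z = 2ⁿ (cosh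
β)ᵐ ∑ (tanh β)^|S|, the sum running over the left kernel of H
(`partitionFunction_eq_sum_dependentRowSets`). Since 0 ≤ tanh β ≤ 1 and ∅ contributes 1, this sum
lies between 1 and the size of the kernel. It therefore suffices that the kernel is almost surely
eventually of polynomial size.

This follows from a first moment bound. Fix a set S of w checks. A uniform matching pulls its
sockets back to a uniform set of k = wΔC bit sockets, and S is dependent iff that set meets every
bit evenly. An even set is determined by all but one of its columns, so at most a fraction (n+1)^ΔB
· C(nΔB, k)^(-1/ΔB) of the k-sets are even. As ΔB ≤ ΔC, this fraction is at most (n+1)^ΔB / C(m, w),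
which cancels the number of choices of S. The expected kernel size is thus at most (m+1)(n+1)^ΔB,
and Markov with Borel–Cantelli concludes. The exceptional null set does not involve β. -/

/-! ### Binomial inequalities and uniform matchings. -/

theorem Nat.choose_mul_choose_le_choose_add (a b x y : ℕ) :
    a.choose x * b.choose y ≤ (a + b).choose (x + y) := by
  rw [Nat.add_choose_eq]
  exact Finset.single_le_sum (f := fun ij : ℕ × ℕ => a.choose ij.1 * b.choose ij.2)
    (fun _ _ => Nat.zero_le _) (a := (x, y)) (by simp)

theorem Finset.prod_choose_le_choose_sum {ι : Type*} (s : Finset ι) (a k : ι → ℕ) :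
    ∏ i ∈ s, (a i).choose (k i) ≤ (∑ i ∈ s, a i).choose (∑ i ∈ s, k i) := by
  classical
  induction s using Finset.induction_on with
  | empty => simp
  | insert i s hi ih =>
    rw [Finset.prod_insert hi, Finset.sum_insert hi, Finset.sum_insert hi]
    exact (Nat.mul_le_mul_left _ ih).trans (Nat.choose_mul_choose_le_choose_add _ _ _ _)

theorem Nat.choose_pow_le_choose_mul (m w r : ℕ) :
    (m.choose w) ^ r ≤ (m * r).choose (w * r) := by
  simpa [mul_comm] using
    Finset.prod_choose_le_choose_sum (Finset.range r) (fun _ => m) (fun _ => w)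

/-- The number of bijections carrying a subset `T` to `U` does not depend on `T`, so it is the
total number of bijections divided by the number of subsets of that size. -/
theorem card_equiv_preimage_eq_mul_choose {α β : Type*} [Fintype α] [Fintype β] [DecidableEq α]
    [DecidableEq β] (U : Finset β) (T : Finset α) (hT : T.card = U.card) :
    (Finset.univ.filter fun e : α ≃ β => ∀ x, e x ∈ U ↔ x ∈ T).card *
        (Fintype.card α).choose U.card = Fintype.card (α ≃ β) := by
  have key : ∀ T' ∈ Finset.powersetCard U.card (Finset.univ : Finset α),
      (Finset.univ.filter fun e : α ≃ β => Finset.univ.filter (fun x => e x ∈ U) = T').card =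
      (Finset.univ.filter fun e : α ≃ β => ∀ x, e x ∈ U ↔ x ∈ T).card := by
    intro T' hT'
    have hc : T.card = T'.card := by rw [hT, (Finset.mem_powersetCard.1 hT').2]
    let σ₀ : {x // x ∈ T} ≃ {x // x ∈ T'} := Finset.equivOfCardEq hc
    let σ : Equiv.Perm α := σ₀.extendSubtype
    have hσ : ∀ x, σ x ∈ T' ↔ x ∈ T := fun x => by
      by_cases hx : x ∈ T
      · exact iff_of_true (σ₀.extendSubtype_mem x hx) hx
      · exact iff_of_false (σ₀.extendSubtype_not_mem x hx) hx
    -- Precomposition with a permutation carrying `T` to `T'` identifies the two fibres.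
    refine Finset.card_bij' (fun e _ => σ.trans e) (fun e _ => σ.symm.trans e) ?_ ?_ ?_ ?_
    · intro e he
      simp only [Finset.mem_filter, Finset.mem_univ, true_and, Finset.ext_iff] at he ⊢
      intro x
      rw [← hσ, ← he]; rfl
    · intro e he
      simp only [Finset.mem_filter, Finset.mem_univ, true_and, Finset.ext_iff] at he ⊢
      intro x
      have := he (σ.symm x)
      rw [← hσ, Equiv.apply_symm_apply] at this
      exact this
    · intro e _; ext; simp
    · intro e _; ext; simp
  have hsum := Finset.card_eq_sum_card_fiberwise (s := (Finset.univ : Finset (α ≃ β)))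
    (t := Finset.powersetCard U.card (Finset.univ : Finset α))
    (f := fun e => Finset.univ.filter (fun x => e x ∈ U)) (by
      intro e _
      simp only [Finset.mem_coe, Finset.mem_powersetCard]
      refine ⟨Finset.subset_univ _, ?_⟩
      refine Finset.card_bij (fun x _ => e x) (fun x hx => by simpa using hx)
        (fun x _ y _ h => e.injective h) (fun y hy => ⟨e.symm y, by simpa using hy, by simp⟩))
  rw [Finset.sum_congr rfl key, Finset.sum_const, Finset.card_powersetCard, Finset.card_univ,
    Finset.card_univ, smul_eq_mul] at hsum
  rw [hsum, mul_comm]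

/-! ### Counting even socket sets. -/

/-- The sets of bit sockets that meet every bit in an even number of sockets. -/
def evenSocketSets (n d : ℕ) : Finset (Finset (Fin n × Fin d)) :=
  Finset.univ.filter fun T => ∀ i, Even (Finset.univ.filter fun a => (i, a) ∈ T).card

/-- The bits whose `a`-th socket lies in `T`. -/
def socketColumn {n d : ℕ} (T : Finset (Fin n × Fin d)) (a : Fin d) : Finset (Fin n) :=
  Finset.univ.filter fun i => (i, a) ∈ T

theorem card_eq_sum_card_socketColumn {n d : ℕ} (T : Finset (Fin n × Fin d)) :
    T.card = ∑ a, (socketColumn T a).card := by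
  rw [Finset.card_eq_sum_card_fiberwise (t := Finset.univ) (f := Prod.snd) (by simp)]
  refine Finset.sum_congr rfl fun a _ => ?_
  refine Finset.card_bij (fun x _ => x.1) ?_ ?_ ?_
  · rintro ⟨i, b⟩ h
    simp only [Finset.mem_filter] at h
    obtain ⟨h, rfl⟩ := h
    simpa [socketColumn] using h
  · rintro ⟨i, b⟩ h ⟨i', b'⟩ h' e
    simp only [Finset.mem_filter] at h h'
    exact Prod.ext e (h.2.trans h'.2.symm)
  · intro i hi
    exact ⟨(i, a), by simpa [socketColumn] using hi, rfl⟩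

/-- An even socket set is determined by all of its columns but one. -/
theorem evenSocketSets_eq_of_socketColumn_eq {n d : ℕ} {T T' : Finset (Fin n × Fin d)}
    (hT : T ∈ evenSocketSets n d) (hT' : T' ∈ evenSocketSets n d) (b : Fin d)
    (h : ∀ a ≠ b, socketColumn T a = socketColumn T' a) : T = T' := by
  have hoff : ∀ i, ∀ a ≠ b, ((i, a) ∈ T ↔ (i, a) ∈ T') := fun i a ha => by
    simpa [socketColumn] using Finset.ext_iff.1 (h a ha) i
  have hsplit : ∀ (R : Finset (Fin n × Fin d)) i,
      (Finset.univ.filter fun a => (i, a) ∈ R).card =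
        (if (i, b) ∈ R then 1 else 0) +
          ∑ a ∈ Finset.univ.erase b, if (i, a) ∈ R then 1 else 0 := fun R i => by
    rw [Finset.card_filter, Finset.add_sum_erase _ (fun a => if (i, a) ∈ R then 1 else 0)
      (Finset.mem_univ b)]
  ext ⟨i, a⟩
  by_cases ha : a = b
  · subst ha
    have h1 := (Finset.mem_filter.1 hT).2 i
    have h2 := (Finset.mem_filter.1 hT').2 i
    rw [hsplit] at h1 h2
    have h3 : (∑ c ∈ Finset.univ.erase a, if (i, c) ∈ T then 1 else 0) =
        ∑ c ∈ Finset.univ.erase a, if (i, c) ∈ T' then 1 else 0 :=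
      Finset.sum_congr rfl fun c hc => by simp [hoff i c (Finset.ne_of_mem_erase hc)]
    rw [h3] at h1
    rw [Nat.even_add] at h1 h2
    by_cases p : (i, a) ∈ T <;> by_cases q : (i, a) ∈ T' <;>
      simp only [p, q, if_true, if_false, Nat.not_even_one, Even.zero, true_iff, false_iff] at h1 h2 ⊢
    · exact h1 h2
    · exact (h2 h1).elim
  · exact hoff i a ha

/-- The number of even socket sets with prescribed column sizes. -/
theorem card_evenSocketSets_columns_mul_choose_le {n d : ℕ} (κ : Fin d → ℕ) (b : Fin d) :
    ((evenSocketSets n d).filter fun T => ∀ a, (socketColumn T a).card = κ a).card *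
      n.choose (κ b) ≤ ∏ a, n.choose (κ a) := by
  rw [← Finset.mul_prod_erase _ (fun a => n.choose (κ a)) (Finset.mem_univ b), mul_comm]
  refine Nat.mul_le_mul_left _ ?_
  have : ∏ a ∈ Finset.univ.erase b, n.choose (κ a) =
      ((Finset.univ.erase b).pi fun a =>
        Finset.powersetCard (κ a) (Finset.univ : Finset (Fin n))).card := by
    simp [Finset.card_pi]
  rw [this]
  -- Forgetting column `b` is injective on even sets.
  refine Finset.card_le_card_of_injOn (fun T a _ => socketColumn T a) ?_ ?_
  · intro T hT
    simp only [Finset.coe_filter, Set.mem_ofPred_eq] at hT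
    simp [Finset.mem_pi, Finset.mem_powersetCard, hT.2]
  · intro T hT T' hT' h
    simp only [Finset.coe_filter, Set.mem_ofPred_eq] at hT hT'
    refine evenSocketSets_eq_of_socketColumn_eq hT.1 hT'.1 b fun a ha => ?_
    exact congrFun (congrFun h a) (Finset.mem_erase.2 ⟨ha, Finset.mem_univ _⟩)

/-- For fixed column sizes let P be the product of the binomials and N the number of even sets. Each
column b gives N · C(n, κ b) ≤ P; multiplying over b gives N^d ≤ P^(d-1), with P ≤ C(nd, k). The
factor (n+1)^d counts the column profiles, and `c` stands for a d-th root of C(nd, k), avoiding real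
exponents. -/
theorem card_evenSocketSets_mul_le {n d k c : ℕ} (hd : 1 ≤ d) (hc : c ^ d ≤ (n * d).choose k) :
    ((evenSocketSets n d).filter fun T => T.card = k).card * c ≤
      (n + 1) ^ d * (n * d).choose k := by
  have hcol : ∀ κ : Fin d → Fin (n + 1),
      (((evenSocketSets n d).filter fun T => T.card = k).filter fun T =>
        (fun a => (⟨(socketColumn T a).card, Nat.lt_succ_of_le
          ((Finset.card_le_univ _).trans_eq (Fintype.card_fin n))⟩ : Fin (n + 1))) = κ).card * c ≤
        (n * d).choose k := by
    intro κ
    set F := ((evenSocketSets n d).filter fun T => T.card = k).filter fun T =>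
        (fun a => (⟨(socketColumn T a).card, Nat.lt_succ_of_le
          ((Finset.card_le_univ _).trans_eq (Fintype.card_fin n))⟩ : Fin (n + 1))) = κ with hF
    rcases F.eq_empty_or_nonempty with h0 | ⟨T₀, hT₀⟩
    · simp [h0]
    have hFcol : ∀ T ∈ F, ∀ a, (socketColumn T a).card = κ a := fun T hT a =>
      congrArg Fin.val (congrFun (Finset.mem_filter.1 hT).2 a)
    have hk : ∑ a, (κ a : ℕ) = k := by
      rw [← (Finset.mem_filter.1 (Finset.mem_filter.1 hT₀).1).2, card_eq_sum_card_socketColumn T₀]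
      exact Finset.sum_congr rfl fun a _ => (hFcol T₀ hT₀ a).symm
    set P := ∏ a, n.choose (κ a) with hP
    have hPpos : 0 < P := Finset.prod_pos fun a _ =>
      Nat.choose_pos (Nat.le_of_lt_succ (κ a).2)
    have hPC : P ≤ (n * d).choose k := by
      have := Finset.prod_choose_le_choose_sum Finset.univ (fun _ : Fin d => n)
        (fun a => (κ a : ℕ))
      simpa [hk, mul_comm] using this
    have hb : ∀ b, F.card * n.choose (κ b) ≤ P := fun b => by
      refine le_trans (Nat.mul_le_mul_right _ (Finset.card_le_card ?_))
        (card_evenSocketSets_columns_mul_choose_le (fun a => (κ a : ℕ)) b)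
      intro T hT
      exact Finset.mem_filter.2
        ⟨(Finset.mem_filter.1 (Finset.mem_filter.1 hT).1).1, hFcol T hT⟩
    have hprod : F.card ^ d * P ≤ P ^ d := by
      have := Finset.prod_le_prod' (s := Finset.univ) fun b _ => hb b
      simpa [Finset.prod_mul_distrib] using this
    obtain ⟨e, rfl⟩ : ∃ e, d = e + 1 := ⟨d - 1, by omega⟩
    have hFe : F.card ^ (e + 1) ≤ P ^ e := by
      rw [pow_succ P e] at hprod
      exact Nat.le_of_mul_le_mul_right hprod hPpos
    -- Comparing d-th powers brings in the hypothesis on `c`.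
    refine le_of_pow_le_pow_left₀ (Nat.succ_ne_zero e) (Nat.zero_le _) ?_
    calc (F.card * c) ^ (e + 1) = F.card ^ (e + 1) * c ^ (e + 1) := mul_pow _ _ _
      _ ≤ P ^ e * (n * (e + 1)).choose k := Nat.mul_le_mul hFe hc
      _ ≤ ((n * (e + 1)).choose k) ^ e * (n * (e + 1)).choose k :=
          Nat.mul_le_mul_right _ (Nat.pow_le_pow_left hPC e)
      _ = _ := (pow_succ _ _).symm
  rw [Finset.card_eq_sum_card_fiberwise (t := Finset.univ)
    (f := fun T (a : Fin d) => (⟨(socketColumn T a).card, Nat.lt_succ_of_le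
          ((Finset.card_le_univ _).trans_eq (Fintype.card_fin n))⟩ : Fin (n + 1))) (by simp),
    Finset.sum_mul]
  refine (Finset.sum_le_sum fun κ _ => hcol κ).trans ?_
  simp

/-! ### Left kernel and high-temperature expansion. -/

/-- The sets of rows of `H` that sum to zero: the left kernel of `H`. -/
def dependentRowSets {n m : ℕ} (H : Matrix (Fin m) (Fin n) (ZMod 2)) : Finset (Finset (Fin m)) :=
  Finset.univ.filter fun S => ∀ i, ∑ c ∈ S, H c i = 0

theorem ZMod.sum_two_eq_card_filter {ι : Type*} (S : Finset ι) (h : ι → ZMod 2) :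
    ∑ c ∈ S, h c = ((S.filter fun c => h c = 1).card : ZMod 2) := by
  rw [Finset.card_filter, Nat.cast_sum]
  refine Finset.sum_congr rfl fun c _ => ?_
  generalize h c = x
  revert x
  decide

theorem sum_intUnits_pow (k : ℕ) :
    ∑ u : ℤˣ, (((u : ℤˣ) : ℤ) : ℝ) ^ k = if Even k then 2 else 0 := by
  have : (Finset.univ : Finset ℤˣ) = {1, -1} := rfl
  rw [this, Finset.sum_pair (by decide)]
  by_cases h : Even k
  · simp [h]; norm_num
  · simp [h, (Nat.not_even_iff_odd.1 h).neg_one_pow]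

/-- Orthogonality of characters: the product over S is the monomial ∏ z_i^(k_i), with k_i the number
of rows of S having a 1 at i. Its spin sum vanishes unless every k_i is even. -/
theorem sum_spins_prod_rows {n m : ℕ} (H : Matrix (Fin m) (Fin n) (ZMod 2))
    (S : Finset (Fin m)) :
    ∑ z : Fin n → ℤˣ, ∏ c ∈ S,
        ∏ i ∈ Finset.univ.filter (fun i : Fin n => H c i = 1), (((z i : ℤˣ) : ℤ) : ℝ) =
      if S ∈ dependentRowSets H then 2 ^ n else 0 := by
  have h1 : ∀ z : Fin n → ℤˣ, ∏ c ∈ S,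
      ∏ i ∈ Finset.univ.filter (fun i : Fin n => H c i = 1), (((z i : ℤˣ) : ℤ) : ℝ) =
      ∏ i, (((z i : ℤˣ) : ℤ) : ℝ) ^ (S.filter fun c => H c i = 1).card := fun z => by
    simp_rw [Finset.prod_filter]
    rw [Finset.prod_comm]
    refine Finset.prod_congr rfl fun i _ => ?_
    rw [← Finset.prod_filter, Finset.prod_const]
  simp_rw [h1]
  rw [← Fintype.prod_sum (fun (i : Fin n) (u : ℤˣ) =>
    (((u : ℤˣ) : ℤ) : ℝ) ^ (S.filter fun c => H c i = 1).card)]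
  simp_rw [sum_intUnits_pow]
  have h2 : S ∈ dependentRowSets H ↔ ∀ i, Even (S.filter fun c => H c i = 1).card := by
    simp only [dependentRowSets, Finset.mem_filter, Finset.mem_univ, true_and,
      ZMod.sum_two_eq_card_filter, ZMod.natCast_eq_zero_iff_even]
  by_cases h : S ∈ dependentRowSets H
  · rw [if_pos h, Finset.prod_congr rfl fun i _ => if_pos (h2.1 h i)]
    simp
  · rw [if_neg h]
    rw [h2] at h
    push Not at h
    obtain ⟨i, hi⟩ := h
    exact Finset.prod_eq_zero (Finset.mem_univ i) (if_neg (by simpa using hi))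

theorem Real.exp_mul_intUnit (β : ℝ) (u : ℤˣ) :
    Real.exp (β * ((u : ℤ) : ℝ)) = Real.cosh β * (1 + Real.tanh β * ((u : ℤ) : ℝ)) := by
  have hc : Real.cosh β ≠ 0 := (Real.cosh_pos β).ne'
  rw [Real.tanh_eq_sinh_div_cosh]
  rcases Int.units_eq_one_or u with rfl | rfl
  · field_simp
    simp [Real.cosh_add_sinh]
  · field_simp
    simp only [Units.val_neg, Units.val_one, Int.cast_neg, Int.cast_one, mul_neg, mul_one]
    rw [← Real.cosh_sub_sinh]
    ring

/-- The high-temperature expansion of the partition function. -/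
theorem partitionFunction_eq_sum_dependentRowSets {n m : ℕ}
    (H : Matrix (Fin m) (Fin n) (ZMod 2)) (β : ℝ) :
    partitionFunction H β =
      2 ^ n * Real.cosh β ^ m * ∑ S ∈ dependentRowSets H, Real.tanh β ^ S.card := by
  have hz : ∀ z : Fin n → ℤˣ, Real.exp (-β * codeHamiltonian H z) =
      Real.cosh β ^ m * ∑ S : Finset (Fin m), Real.tanh β ^ S.card * ∏ c ∈ S,
        ∏ i ∈ Finset.univ.filter (fun i : Fin n => H c i = 1), (((z i : ℤˣ) : ℤ) : ℝ) := by
    intro z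
    have hu : ∀ c, ∏ i ∈ Finset.univ.filter (fun i : Fin n => H c i = 1),
        (((z i : ℤˣ) : ℤ) : ℝ) =
        (((∏ i ∈ Finset.univ.filter (fun i : Fin n => H c i = 1), z i : ℤˣ) : ℤ) : ℝ) := by
      intro c; push_cast; rfl
    rw [codeHamiltonian, neg_mul_neg, Finset.mul_sum, Real.exp_sum]
    simp_rw [hu, Real.exp_mul_intUnit]
    rw [Finset.prod_mul_distrib, Finset.prod_const, Finset.card_univ, Fintype.card_fin]
    congr 1
    -- Expanding the product of the factors 1 + tanh β · (…) yields one term per set of checks.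
    rw [Finset.prod_one_add]
    simp [Finset.prod_mul_distrib]
  rw [partitionFunction]
  simp_rw [hz]
  rw [← Finset.mul_sum, Finset.sum_comm]
  simp_rw [← Finset.mul_sum, sum_spins_prod_rows, mul_ite, mul_zero]
  rw [← Finset.sum_filter, Finset.filter_univ_mem, ← Finset.sum_mul]
  ring

theorem log_partitionFunction {n m : ℕ} (H : Matrix (Fin m) (Fin n) (ZMod 2)) {β : ℝ}
    (hβ : 0 < β) : ∃ r : ℝ, 0 ≤ r ∧ r ≤ Real.log (dependentRowSets H).card ∧
      Real.log (partitionFunction H β) = n * Real.log 2 + m * Real.log (Real.cosh β) + r := by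
  have ht0 : 0 ≤ Real.tanh β := by
    rw [Real.tanh_eq_sinh_div_cosh]
    exact div_nonneg (Real.sinh_nonneg_iff.2 hβ.le) (Real.cosh_pos β).le
  have ht1 : Real.tanh β ≤ 1 := (Real.tanh_lt_one β).le
  have hlow : 1 ≤ ∑ S ∈ dependentRowSets H, Real.tanh β ^ S.card := by
    have := Finset.single_le_sum (s := dependentRowSets H)
      (f := fun S : Finset (Fin m) => Real.tanh β ^ S.card)
      (fun S _ => pow_nonneg ht0 _) (a := ∅) (by simp [dependentRowSets])
    simpa using this
  have hup : ∑ S ∈ dependentRowSets H, Real.tanh β ^ S.card ≤ (dependentRowSets H).card := by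
    have := Finset.sum_le_sum (s := dependentRowSets H)
      fun S _ => pow_le_one₀ (n := S.card) ht0 ht1
    simpa using this
  refine ⟨_, Real.log_nonneg hlow, Real.log_le_log (by linarith) hup, ?_⟩
  have hc := Real.cosh_pos β
  rw [partitionFunction_eq_sum_dependentRowSets, Real.log_mul (by positivity) (by linarith),
    Real.log_mul (by positivity) (by positivity), Real.log_pow, Real.log_pow]

/-! ### First moment of the left kernel. -/

instance TannerGraph.instFintype (ΔB ΔC n m : ℕ) : Fintype (TannerGraph ΔB ΔC n m) :=
  inferInstanceAs (Fintype ((Fin n × Fin ΔB) ≃ (Fin m × Fin ΔC)))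

/-- The matching of sockets underlying a Tanner graph. -/
def TannerGraph.matching {ΔB ΔC n m : ℕ} (G : TannerGraph ΔB ΔC n m) :
    (Fin n × Fin ΔB) ≃ (Fin m × Fin ΔC) :=
  G

theorem TannerGraph.mem_dependentRowSets_iff {ΔB ΔC n m : ℕ} (G : TannerGraph ΔB ΔC n m)
    (S : Finset (Fin m)) :
    S ∈ dependentRowSets G.parityCheck ↔
      ∀ i, Even (Finset.univ.filter fun a => G.check i a ∈ S).card := by
  rw [dependentRowSets, Finset.mem_filter, and_iff_right (Finset.mem_univ _)]
  simp only [TannerGraph.parityCheck]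
  refine forall_congr' fun i => ?_
  rw [← Nat.cast_sum, ZMod.natCast_eq_zero_iff_even]
  rw [Finset.card_eq_sum_card_fiberwise (s := Finset.univ.filter fun a => G.check i a ∈ S)
    (t := S) (f := G.check i) (fun a ha => (Finset.mem_filter.1 ha).2)]
  have : ∀ c ∈ S, ((Finset.univ.filter fun a => G.check i a ∈ S).filter
      fun a => G.check i a = c).card = (Finset.univ.filter fun a => G.check i a = c).card := by
    intro c hc
    congr 1
    ext a
    simp only [Finset.mem_filter, Finset.mem_univ, true_and, and_iff_right_iff_imp]
    rintro rfl
    exact hc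
  rw [Finset.sum_congr rfl this]

/-- Graphs making S dependent are sorted by the even socket set to which S pulls back; all fibres
have the same bound |graphs| / C(nΔB, k), so the count of even sets applies. -/
theorem TannerGraph.card_dependent_mul_choose_le {ΔB ΔC n m : ℕ} (hB : 1 ≤ ΔB) (hBC : ΔB ≤ ΔC)
    (hnm : n * ΔB = m * ΔC) (S : Finset (Fin m)) :
    (Finset.univ.filter fun G : TannerGraph ΔB ΔC n m =>
        S ∈ dependentRowSets G.parityCheck).card * m.choose S.card ≤
      (n + 1) ^ ΔB * Fintype.card (TannerGraph ΔB ΔC n m) := by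
  set U : Finset (Fin m × Fin ΔC) := S ×ˢ Finset.univ with hU
  have hUcard : U.card = S.card * ΔC := by simp [hU]
  have hSm : S.card ≤ m := (Finset.card_le_univ S).trans_eq (Fintype.card_fin m)
  have hmaps : ∀ G : TannerGraph ΔB ΔC n m, S ∈ dependentRowSets G.parityCheck →
      Finset.univ.filter (fun x => G.matching x ∈ U) ∈
        (evenSocketSets n ΔB).filter fun T => T.card = U.card := by
    intro G hG
    rw [G.mem_dependentRowSets_iff] at hG
    refine Finset.mem_filter.2 ⟨Finset.mem_filter.2 ⟨Finset.mem_univ _, fun i => ?_⟩, ?_⟩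
    · have h := hG i
      simp only [hU, Finset.mem_filter, Finset.mem_univ, true_and, Finset.mem_product, and_true]
      exact h
    · exact Finset.card_bij (fun x _ => G.matching x) (fun x hx => by simpa using hx)
        (fun x _ y _ h => G.matching.injective h)
        (fun y hy => ⟨G.matching.symm y, by simpa using hy, by simp⟩)
  have hcount : (Finset.univ.filter fun G : TannerGraph ΔB ΔC n m =>
        S ∈ dependentRowSets G.parityCheck).card * (n * ΔB).choose U.card ≤
      ((evenSocketSets n ΔB).filter fun T => T.card = U.card).card *
        Fintype.card (TannerGraph ΔB ΔC n m) := by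
    rw [Finset.card_eq_sum_card_fiberwise (t := (evenSocketSets n ΔB).filter
        fun T => T.card = U.card)
      (f := fun G : TannerGraph ΔB ΔC n m => Finset.univ.filter fun x => G.matching x ∈ U)
      (fun G hG => hmaps G (Finset.mem_filter.1 hG).2), Finset.sum_mul]
    refine Finset.sum_le_card_nsmul _ _ _ fun T hT => ?_
    have h := card_equiv_preimage_eq_mul_choose U T (Finset.mem_filter.1 hT).2
    rw [Fintype.card_prod, Fintype.card_fin, Fintype.card_fin] at h
    refine le_trans (Nat.mul_le_mul_right _ (Finset.card_le_card_of_injOn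
      TannerGraph.matching (fun G hG => ?_) (fun _ _ _ _ h => h))) h.le
    simp [← (Finset.mem_filter.1 hG).2]
  -- The only use of ΔB ≤ ΔC here: it lets C(m, w) serve as the root `c`.
  have hpow : (m.choose S.card) ^ ΔB ≤ (n * ΔB).choose U.card := by
    rw [hnm, hUcard]
    exact (Nat.pow_le_pow_right (Nat.choose_pos hSm) hBC).trans
      (Nat.choose_pow_le_choose_mul _ _ _)
  have hA := card_evenSocketSets_mul_le hB hpow
  have hCpos : 0 < (n * ΔB).choose U.card := by
    rw [hnm, hUcard]
    exact Nat.choose_pos (Nat.mul_le_mul_right _ hSm)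
  refine Nat.le_of_mul_le_mul_right ?_ hCpos
  calc _ = (Finset.univ.filter fun G : TannerGraph ΔB ΔC n m =>
        S ∈ dependentRowSets G.parityCheck).card * (n * ΔB).choose U.card *
          m.choose S.card := by ring
    _ ≤ ((evenSocketSets n ΔB).filter fun T => T.card = U.card).card *
        Fintype.card (TannerGraph ΔB ΔC n m) * m.choose S.card := Nat.mul_le_mul_right _ hcount
    _ = ((evenSocketSets n ΔB).filter fun T => T.card = U.card).card * m.choose S.card *
        Fintype.card (TannerGraph ΔB ΔC n m) := by ring
    _ ≤ (n + 1) ^ ΔB * (n * ΔB).choose U.card * Fintype.card (TannerGraph ΔB ΔC n m) :=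
        Nat.mul_le_mul_right _ hA
    _ = _ := by ring

/-- Each of the m+1 sizes w contributes at most X, since its C(m, w) sets cancel the binomial. -/
theorem Finset.sum_le_of_mul_choose_le {m X : ℕ} {g : Finset (Fin m) → ℕ}
    (hg : ∀ S, g S * m.choose S.card ≤ X) : ∑ S, g S ≤ (m + 1) * X := by
  rw [← Finset.powerset_univ, Finset.sum_powerset, Finset.card_univ, Fintype.card_fin]
  refine (Finset.sum_le_card_nsmul _ _ X fun w hw => ?_).trans (by simp)
  have hpos : 0 < m.choose w := Nat.choose_pos (Nat.le_of_lt_succ (Finset.mem_range.1 hw))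
  refine Nat.le_of_mul_le_mul_right ?_ hpos
  rw [Finset.sum_mul]
  refine (Finset.sum_le_card_nsmul _ _ X fun S hS => ?_).trans ?_
  · rw [← (Finset.mem_powersetCard.1 hS).2]
    exact hg S
  · simp [mul_comm]

/-- First moment bound for the size of the left kernel of the parity-check matrix. -/
theorem TannerGraph.sum_card_dependentRowSets_le {ΔB ΔC n m : ℕ} (hB : 1 ≤ ΔB) (hBC : ΔB ≤ ΔC)
    (hnm : n * ΔB = m * ΔC) :
    ∑ G : TannerGraph ΔB ΔC n m, (dependentRowSets G.parityCheck).card ≤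
      (m + 1) * ((n + 1) ^ ΔB * Fintype.card (TannerGraph ΔB ΔC n m)) := by
  refine le_trans (le_of_eq ?_) (Finset.sum_le_of_mul_choose_le fun S =>
    TannerGraph.card_dependent_mul_choose_le hB hBC hnm S)
  simp_rw [Finset.card_filter]
  rw [Finset.sum_comm]
  simp_rw [← Finset.card_filter, Finset.filter_univ_mem]

/-- Markov's inequality. As m ≤ n, the mean is at most (n+1)^(ΔB+1); two further powers in the
threshold make the tail summable. -/
theorem ldpcEnsemble_dependentRowSets_large_le {ΔB ΔC n m : ℕ} (hB : 1 ≤ ΔB) (hBC : ΔB ≤ ΔC)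
    (hnm : n * ΔB = m * ΔC) :
    ldpcEnsemble ΔB ΔC n m
        {G | (n + 1) ^ (ΔB + 3) ≤ (dependentRowSets G.parityCheck).card} ≤
      ENNReal.ofReal (1 / ((n : ℝ) + 1) ^ 2) := by
  classical
  set A : Finset (TannerGraph ΔB ΔC n m) := Finset.univ.filter fun G =>
    (n + 1) ^ (ΔB + 3) ≤ (dependentRowSets G.parityCheck).card with hA
  have hmn : m ≤ n := by
    refine Nat.le_of_mul_le_mul_right (c := ΔB) ?_ hB
    rw [hnm]
    exact Nat.mul_le_mul_left _ hBC
  have h1 : A.card * (n + 1) ^ (ΔB + 3) ≤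
      (n + 1) ^ (ΔB + 1) * Fintype.card (TannerGraph ΔB ΔC n m) := by
    calc A.card * (n + 1) ^ (ΔB + 3)
        ≤ ∑ G ∈ A, (dependentRowSets G.parityCheck).card := by
          rw [← smul_eq_mul]
          exact Finset.card_nsmul_le_sum _ _ _ fun G hG => (Finset.mem_filter.1 hG).2
      _ ≤ ∑ G : TannerGraph ΔB ΔC n m, (dependentRowSets G.parityCheck).card :=
          Finset.sum_le_sum_of_subset (Finset.subset_univ _)
      _ ≤ (m + 1) * ((n + 1) ^ ΔB * Fintype.card (TannerGraph ΔB ΔC n m)) :=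
          TannerGraph.sum_card_dependentRowSets_le hB hBC hnm
      _ ≤ (n + 1) * ((n + 1) ^ ΔB * Fintype.card (TannerGraph ΔB ΔC n m)) :=
          Nat.mul_le_mul_right _ (Nat.succ_le_succ hmn)
      _ = _ := by ring
  have h2 : A.card * (n + 1) ^ 2 ≤ Fintype.card (TannerGraph ΔB ΔC n m) := by
    refine le_of_mul_le_mul_left ?_ (by positivity : 0 < (n + 1) ^ (ΔB + 1))
    refine le_trans (le_of_eq ?_) h1
    ring
  have hne : Nonempty (TannerGraph ΔB ΔC n m) :=
    ⟨Fintype.equivOfCardEq (by simpa using hnm)⟩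
  have hpos : 0 < Fintype.card (TannerGraph ΔB ΔC n m) := Fintype.card_pos
  have hcoe : {G : TannerGraph ΔB ΔC n m |
      (n + 1) ^ (ΔB + 3) ≤ (dependentRowSets G.parityCheck).card} = (A : Set _) := by
    ext G; simp [hA]
  have : MeasurableSingletonClass (TannerGraph ΔB ΔC n m) := ⟨fun _ => trivial⟩
  rw [ldpcEnsemble, hcoe, uniformOn_univ, Measure.count_apply_finset,
    ← ENNReal.ofReal_natCast, ← ENNReal.ofReal_natCast (Fintype.card _),
    ← ENNReal.ofReal_div_of_pos (by exact_mod_cast hpos)]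
  refine ENNReal.ofReal_le_ofReal ?_
  rw [div_le_div_iff₀ (by exact_mod_cast hpos) (by positivity), one_mul]
  exact_mod_cast h2

/-! ### Passage to the limit and Borel–Cantelli. -/

theorem tendsto_log_succ_div_atTop :
    Tendsto (fun k : ℕ => Real.log ((k : ℝ) + 1) / k) atTop (𝓝 0) := by
  have h := (Real.isLittleO_log_id_atTop.tendsto_div_nhds_zero).comp
    (tendsto_natCast_atTop_atTop.comp (tendsto_add_atTop_nat 1) : Tendsto
      (fun k : ℕ => ((k + 1 : ℕ) : ℝ)) atTop atTop)
  have h2 : Tendsto (fun k : ℕ => ((k : ℝ) + 1) / k) atTop (𝓝 1) := by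
    have := (tendsto_const_nhds (x := (1 : ℝ))).add
      (tendsto_one_div_atTop_nhds_zero_nat (𝕜 := ℝ))
    rw [add_zero] at this
    refine this.congr' ?_
    filter_upwards [eventually_gt_atTop 0] with k hk
    have : (k : ℝ) ≠ 0 := by positivity
    field_simp
  have h3 := h.mul h2
  rw [zero_mul] at h3
  refine h3.congr fun k => ?_
  have : (k : ℝ) + 1 ≠ 0 := by positivity
  simp only [Function.comp, id, Nat.cast_add, Nat.cast_one]
  field_simp

/-- Deterministic part: a polynomially bounded kernel changes log Z by O(log n), which vanishes per
bit. -/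
theorem tendsto_freeEnergyPerBit {ΔB ΔC : ℕ} (hC : 0 < ΔC) {n m : ℕ → ℕ}
    (hn : StrictMono n) (hnm : ∀ j, n j * ΔB = m j * ΔC)
    {H : ∀ j, Matrix (Fin (m j)) (Fin (n j)) (ZMod 2)} (p : ℕ)
    (hH : ∀ᶠ j in atTop, (dependentRowSets (H j)).card < (n j + 1) ^ p) {β : ℝ} (hβ : 0 < β) :
    Tendsto (fun j => freeEnergyPerBit (H j) β) atTop
      (𝓝 (-(1 / β) * (Real.log 2 + ((ΔB : ℝ) / (ΔC : ℝ)) * Real.log (Real.cosh β)))) := by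
  choose r hr0 hr hlog using fun j => log_partitionFunction (H j) hβ
  have hrlim : Tendsto (fun j => r j / n j) atTop (𝓝 0) := by
    have hu : Tendsto (fun j => (p : ℝ) * (Real.log ((n j : ℝ) + 1) / n j)) atTop (𝓝 0) := by
      simpa using (tendsto_log_succ_div_atTop.comp hn.tendsto_atTop).const_mul (p : ℝ)
    refine tendsto_of_tendsto_of_tendsto_of_le_of_le' tendsto_const_nhds hu
      (Eventually.of_forall fun j => div_nonneg (hr0 j) (Nat.cast_nonneg _)) ?_
    filter_upwards [hH] with j hj
    rw [← mul_div_assoc, ← Real.log_pow]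
    refine div_le_div_of_nonneg_right ((hr j).trans ?_) (Nat.cast_nonneg _)
    refine Real.log_le_log ?_ (by exact_mod_cast hj.le)
    exact_mod_cast Finset.card_pos.2 ⟨∅, by simp [dependentRowSets]⟩
  have hlim := ((hrlim.const_add
    (Real.log 2 + ((ΔB : ℝ) / (ΔC : ℝ)) * Real.log (Real.cosh β))).const_mul (-(1 / β)))
  rw [add_zero] at hlim
  refine hlim.congr' ?_
  filter_upwards [hn.tendsto_atTop.eventually_gt_atTop 0] with j hj
  have hnj : (n j : ℝ) ≠ 0 := by positivity
  have hCj : (ΔC : ℝ) ≠ 0 := by positivity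
  have hratio : (ΔB : ℝ) / ΔC = m j / n j := by
    rw [div_eq_div_iff hCj hnj, mul_comm]
    exact_mod_cast hnm j
  rw [freeEnergyPerBit, hlog, hratio]
  field_simp

theorem mainTheorem5
    (ΔB ΔC : ℕ) (hB : 2 ≤ ΔB) (hBC : ΔB < ΔC)
    (n m : ℕ → ℕ) (hn : StrictMono n) (hnm : ∀ j, n j * ΔB = m j * ΔC)
    {Ω : Type*} [MeasurableSpace Ω] (μ : Measure Ω) [IsProbabilityMeasure μ]
    (G : ∀ j, Ω → TannerGraph ΔB ΔC (n j) (m j))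
    (hG : ∀ j, HasLaw (G j) (ldpcEnsemble ΔB ΔC (n j) (m j)) μ) :
    ∀ᵐ ω ∂μ, ∃ f : ℝ → ℝ,
      (∀ β : ℝ, 0 < β →
        Tendsto (fun j => freeEnergyPerBit (G j ω).parityCheck β) atTop (𝓝 (f β))) ∧
      ContDiffOn ℝ ((⊤ : ℕ∞) : WithTop ℕ∞) f (Set.Ioi 0) ∧
      ∀ β : ℝ, 0 < β →
        f β = -(1 / β) * (Real.log 2 + ((ΔB : ℝ) / (ΔC : ℝ)) * Real.log (Real.cosh β)) := by
  have hprob : ∀ j, μ {ω | (n j + 1) ^ (ΔB + 3) ≤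
      (dependentRowSets (G j ω).parityCheck).card} ≤
        ENNReal.ofReal (1 / ((j : ℝ) + 1) ^ 2) := by
    intro j
    have hpre := Measure.map_apply_of_aemeasurable (hG j).aemeasurable
      (s := {g | (n j + 1) ^ (ΔB + 3) ≤ (dependentRowSets g.parityCheck).card}) trivial
    rw [(hG j).map_eq] at hpre
    refine hpre.symm.le.trans ((ldpcEnsemble_dependentRowSets_large_le (by omega) hBC.le
      (hnm j)).trans (ENNReal.ofReal_le_ofReal ?_))
    -- Strict monotonicity makes the tail bounds summable in j.
    have : (j : ℝ) ≤ n j := by exact_mod_cast hn.le_apply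
    gcongr
  have hsum : ∑' j, μ {ω | (n j + 1) ^ (ΔB + 3) ≤
      (dependentRowSets (G j ω).parityCheck).card} ≠ ⊤ := by
    have hs : Summable fun j : ℕ => 1 / ((j : ℝ) + 1) ^ 2 := by
      simpa using (summable_nat_add_iff 1).2 (Real.summable_one_div_nat_pow.2 one_lt_two)
    exact ne_top_of_le_ne_top hs.tsum_ofReal_ne_top (ENNReal.tsum_le_tsum hprob)
  -- Borel–Cantelli needs no independence, so any joint law is allowed; ω is fixed before β.
  filter_upwards [ae_eventually_notMem hsum] with ω hω
  refine ⟨fun β => -(1 / β) * (Real.log 2 + ((ΔB : ℝ) / (ΔC : ℝ)) * Real.log (Real.cosh β)),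
    fun β hβ => tendsto_freeEnergyPerBit (by omega) hn hnm (ΔB + 3) ?_ hβ, ?_,
    fun β _ => rfl⟩
  · filter_upwards [hω] with j hj using not_le.1 hj
  · have hid : ContDiffOn ℝ ((⊤ : ℕ∞) : WithTop ℕ∞) (fun β : ℝ => 1 / β) (Set.Ioi 0) :=
      contDiffOn_const.div contDiffOn_id fun β hβ => (Set.mem_Ioi.1 hβ).ne'
    have hlog : ContDiff ℝ ((⊤ : ℕ∞) : WithTop ℕ∞) fun β : ℝ => Real.log (Real.cosh β) :=
      Real.contDiff_cosh.log fun β => (Real.cosh_pos β).ne'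
    exact hid.neg.mul (contDiffOn_const.add (contDiffOn_const.mul hlog.contDiffOn))
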